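/- Let $G$ be a finite simple graph with $n$ vertices, let $K$ be a field (for example $K=\mathbb R$), and let every edge $\{p,q\}$ of $G$ carry a weight $c_{pq}=c_{qp}\in K$. Let a line bundle with connection on $G$ be given, that is, a number $\varphi_{pq}\in K\setminus\{0\}$ for every directed edge $(p,q)$, with $\varphi_{qp}=\varphi_{pq}^{-1}$. Its Laplacian is the operator $M$ on $K^n$ with $$(Mv)_i=\sum_{j\,:\,\{i,j\}\in E(G)} c_{ij}\,(v_i-\varphi_{ji}v_j).$$ A mixed forest is a graph in which every connected component is either a tree or a unicycle (a connected graph with as many edges as vertices, so that it contains exactly one cycle). The holonomy of a cycle $p_1,p_2,\dots,p_s,p_1$ is $w=\varphi_{p_1p_2}\varphi_{p_2p_3}\cdots\varphi_{p_sp_1}$; reversing the direction of the cycle replaces $w$ by $1/w$. Then the characteristic polynomial of $M$ is $$\det(tI-M)=\sum_{k=0}^n(-1)^k\mu_k\,t^{\,n-k},\qquad \mu_k=\sum_{F}\ \prod_{\{p,q\}\in E(F)}c_{pq}\ \prod_{i}(m_i+1)\ \prod_{j}(1-w_j)(1-1/w_j),$$ where $F$ runs over the mixed forests with $k$ edges that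 are subgraphs of $G$ and contain all $n$ vertices, $i$ runs over the tree components of $F$, $m_i$ is the number of edges of the $i$-th tree component, $j$ runs over the unicyclic components of $F$, and $w_j$ is the holonomy of the cycle in the $j$-th unicyclic component. Every such $F$ has exactly $n-k$ tree components. -/

import Mathlib

/-- A line bundle with connection on the graph `G` (fibre `K`): a nonzero number `φ p q` attached to
every directed edge `(p, q)` of `G`, with inverse numbers attached to the two directions of an edge.
The values `φ p q` at pairs `(p, q)` which are not edges carry no meaning and are never used. -/
structure LineBundleConnection {V : Type*} (G : SimpleGraph V) (K : Type*) [Field K] where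
  φ : V → V → K
  ne_zero : ∀ p q : V, G.Adj p q → φ p q ≠ 0
  symm_eq_inv : ∀ p q : V, G.Adj p q → φ q p = (φ p q)⁻¹

/-- A connected graph with one cycle: a connected finite graph with as many edges as vertices. -/
def SimpleGraph.IsUnicycle {V : Type*} (H : SimpleGraph V) : Prop :=
  H.Connected ∧ Nat.card H.edgeSet = Nat.card V

/-- A mixed forest: every connected component is either a tree or a connected graph with
one cycle. -/
def SimpleGraph.IsMixedForest {V : Type*} (H : SimpleGraph V) : Prop :=
  ∀ C : H.ConnectedComponent, C.toSimpleGraph.IsTree ∨ C.toSimpleGraph.IsUnicycle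

/-- A connected component with one cycle does contain a cycle. -/
theorem SimpleGraph.ConnectedComponent.exists_cycle_of_isUnicycle {V : Type*} [Finite V]
    {H : SimpleGraph V} {C : H.ConnectedComponent} (hC : C.toSimpleGraph.IsUnicycle) :
    ∃ (v : V) (_ : v ∈ C) (p : H.Walk v v), p.IsCycle := by
  classical
  have : Fintype C := Fintype.ofFinite C
  have hna : ¬ C.toSimpleGraph.IsAcyclic := by
    intro ha
    have ht : C.toSimpleGraph.IsTree := ⟨hC.1, ha⟩
    have h1 := ht.card_edgeFinset
    have h2 := hC.2
    rw [Nat.card_eq_fintype_card, Nat.card_eq_fintype_card, ← SimpleGraph.edgeFinset_card] at h2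
    omega
  unfold SimpleGraph.IsAcyclic at hna
  push Not at hna
  obtain ⟨v, p, hp⟩ := hna
  exact ⟨v.1, v.2, p.map C.toSimpleGraph_hom, hp.map Subtype.val_injective⟩

namespace LineBundleConnection

variable {V : Type*} {G : SimpleGraph V} {K : Type*} [Field K]

/-- Parallel transport along a walk: the product of the numbers `φ p q` over the directed edges
`(p, q)` of the walk, each taken in the direction in which it is traversed. -/
def transport (Φ : LineBundleConnection G K) {H : SimpleGraph V} {u v : V} (p : H.Walk u v) : K :=
  (p.darts.map fun d => Φ.φ d.fst d.snd).prod

/-- The holonomy of the cycle in a component with one cycle, for some choice of the direction and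
of the starting point of the cycle. (Another starting point gives the same number, and the opposite
direction gives the inverse number.) -/
noncomputable def holonomy [Finite V] (Φ : LineBundleConnection G K) {H : SimpleGraph V}
    (C : H.ConnectedComponent) (hC : C.toSimpleGraph.IsUnicycle) : K :=
  Φ.transport
    (SimpleGraph.ConnectedComponent.exists_cycle_of_isUnicycle hC).choose_spec.choose_spec.choose

open Classical in
/-- The Laplacian of the line bundle, for the edge weights `c`:
`(M v)_i = ∑_j c_{ij} (v_i - φ_{ji} v_j)`, the sum over the neighbours `j` of `i` in `G`. -/
noncomputable def laplacian [Fintype V] (Φ : LineBundleConnection G K) (c : Sym2 V → K) :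
    (V → K) →ₗ[K] (V → K) where
  toFun v i := ∑ j with G.Adj i j, c s(i, j) * (v i - Φ.φ j i * v j)
  map_add' v w := by
    funext i
    simp only [Pi.add_apply, ← Finset.sum_add_distrib]
    exact Finset.sum_congr rfl fun j _ => by ring
  map_smul' a v := by
    funext i
    simp only [Pi.smul_apply, smul_eq_mul, RingHom.id_apply, Finset.mul_sum]
    exact Finset.sum_congr rfl fun j _ => by ring

open Classical in
/-- The contribution of a graph `H`: the product of the weights of its edges, times the product of
(number of edges) + 1 over the tree components, times the product of `(1 - w) (1 - 1 / w)` over the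
components with one cycle, where `w` is the holonomy of that cycle. -/
noncomputable def forestWeight [Fintype V] (Φ : LineBundleConnection G K) (c : Sym2 V → K)
    (H : SimpleGraph V) : K :=
  (∏ e ∈ H.edgeFinset, c e) *
    (∏ C : {C : H.ConnectedComponent // C.toSimpleGraph.IsTree},
      ((Nat.card C.1.toSimpleGraph.edgeSet : K) + 1)) *
    ∏ C : {C : H.ConnectedComponent // C.toSimpleGraph.IsUnicycle},
      (1 - Φ.holonomy C.1 C.2) * (1 - 1 / Φ.holonomy C.1 C.2)

end LineBundleConnection

open Classical in
/-- The mixed forests with `k` edges that contain all vertices of `G` and whose edges are edges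
of `G`. -/
noncomputable def SimpleGraph.mixedForests {V : Type*} [Fintype V] (G : SimpleGraph V) (k : ℕ) :
    Finset (SimpleGraph V) :=
  {H : SimpleGraph V | H ≤ G ∧ H.IsMixedForest ∧ Nat.card H.edgeSet = k}

/-! ### Orientations of a graph as partial maps, and their matrices. -/

section OrientedGraphs

open scoped Classical
open Finset

variable {W : Type*}

/-! Row `i` of `tI - M` is `t e_i` plus the sum over the neighbours `j` of `-c_{ij} (e_i - φ_{ji}
e_j)`. Expanding the determinant multilinearly in the rows picks one summand per row, that is, a
partial map `f` (`charpoly_laplacian_eq_sum`). Collecting the `f` with the same set of edges `{i, f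
i}` gives a sum over subgraphs `H` of `G`, weighted by `orientationSum`
(`charpoly_laplacian_eq_sum_graphs`).

If `f` has a 2-cycle, two rows are proportional and the determinant vanishes. The remaining `f`
orient each edge of `H` exactly once, with at most one edge leaving each vertex. Both these
orientations and the determinants factor over the components (`orientationSum_eq_prod`). A tree with
`m` edges has one orientation per root, each of determinant 1, which gives `m + 1`. A unicycle has
two, one per direction of its cycle, with determinants `1 - w` and `1 - 1/w`; their sum equals `(1 -
w)(1 - 1/w)`. Any other connected graph has more edges than vertices, hence no such orientation, so
only mixed forests survive. -/

/-- The graph `H` has exactly the edges `{i, f i}`, for the `i` at which `f` is defined. -/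
def SimpleGraph.IsOrientedBy (H : SimpleGraph W) (f : W → Option W) : Prop :=
  ∀ i j, H.Adj i j ↔ f i = some j ∨ f j = some i

/-- The partial map `f` has neither fixed points nor cycles of length two. -/
def IsAntisymmetricMap (f : W → Option W) : Prop :=
  ∀ i j, f i = some j → f j ≠ some i

/-- The matrix with rows `e_i - φ_{ji} e_j` where `f i = some j`, and `e_i` where `f i = none`. -/
noncomputable def successorMatrix {R : Type*} [CommRing R] (φ : W → W → R) (f : W → Option W) :
    Matrix W W R :=
  Matrix.of fun i j => (if i = j then 1 else 0) - if f i = some j then φ j i else 0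

/-- The sum of the determinants of the successor matrices of the orientations of `H`. -/
noncomputable def orientationSum {R : Type*} [CommRing R] [Fintype W] (φ : W → W → R)
    (H : SimpleGraph W) : R :=
  ∑ f : W → Option W with H.IsOrientedBy f, (successorMatrix φ f).det

theorem perm_apply_inv_apply (σ : Equiv.Perm W) (i : W) : σ (σ⁻¹ i) = i :=
  σ.apply_symm_apply i

/-! ### Determinants of successor matrices. -/

section Determinants

variable {R : Type*} [CommRing R] [Fintype W] {φ : W → W → R} {f : W → Option W}

/-- Row `j` is `-φ i j` times row `i`. -/
theorem det_successorMatrix_eq_zero_of_two_cycle {i j : W} (hij : i ≠ j) (hi : f i = some j)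
    (hj : f j = some i) (h : φ i j * φ j i = 1) : (successorMatrix φ f).det = 0 := by
  rw [← Matrix.det_updateRow_add_smul_self _ hij.symm (φ i j)]
  refine Matrix.det_eq_zero_of_row_eq_zero j fun k => ?_
  have hji := hij.symm
  rcases eq_or_ne k i with rfl | hki
  · simp [successorMatrix, hi, hj, hji]
  · rcases eq_or_ne k j with rfl | hkj
    · simp [successorMatrix, hi, hj, hij, h]
    · simp [successorMatrix, hi, hj, hki.symm, hkj.symm]

/-- Only the permutations which move points along `f` contribute to the determinant. -/
theorem prod_successorMatrix_eq_zero {σ : Equiv.Perm W} {i : W} (h1 : σ i ≠ i)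
    (h2 : f i ≠ some (σ i)) : ∏ i, successorMatrix φ f i (σ i) = 0 :=
  prod_eq_zero (mem_univ i) (by simp [successorMatrix, h1.symm, h2])

theorem prod_successorMatrix_one (hf : IsAntisymmetricMap f) :
    ∏ i, successorMatrix φ f i ((1 : Equiv.Perm W) i) = 1 := by
  refine prod_eq_one fun i _ => ?_
  have : f i ≠ some i := fun h => hf i i h h
  simp [successorMatrix, this]

/-- A cycle of length `s` has sign `(-1)^(s-1)`, and its `s` factors `-φ` contribute `(-1)^s`. -/
theorem sign_mul_prod_successorMatrix {σ : Equiv.Perm W} (hσ : σ.IsCycle)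
    (hf : IsAntisymmetricMap f) (h : ∀ i ∈ σ.support, f i = some (σ i)) :
    ((Equiv.Perm.sign σ : ℤ) : R) * ∏ i, successorMatrix φ f i (σ i) =
      -∏ i ∈ σ.support, φ (σ i) i := by
  have h1 : ∏ i, successorMatrix φ f i (σ i) = ∏ i ∈ σ.support, -φ (σ i) i := by
    rw [← prod_subset (subset_univ σ.support)]
    · refine prod_congr rfl fun i hi => ?_
      have := Equiv.Perm.mem_support.1 hi
      simp [successorMatrix, h i hi, this.symm]
    · intro i _ hi
      rw [Equiv.Perm.notMem_support.1 hi]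
      have : f i ≠ some i := fun h => hf i i h h
      simp [successorMatrix, this]
  rw [h1, hσ.sign, prod_neg, ← mul_assoc]
  push_cast
  rw [neg_mul, ← mul_pow]
  simp

/-- If `f` decreases `d` outside of `Z`, then a permutation which moves points along `f` moves only
points of `Z`. -/
theorem support_subset_of_decreasing {Z : Finset W} {d : W → ℕ} {σ : Equiv.Perm W}
    (hZ : ∀ i ∈ Z, ∀ j, f i = some j → j ∈ Z) (hd : ∀ i ∉ Z, ∀ j, f i = some j → d j < d i)
    (hσ : ∀ i, σ i ≠ i → f i = some (σ i)) : σ.support ⊆ Z := by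
  by_contra hcon
  obtain ⟨a, ha, haZ⟩ := not_subset.1 hcon
  -- At a moved point outside `Z` with maximal `d`, the preimage under `σ` either lies in `Z`, which
  -- `f` does not leave, or has larger `d`.
  obtain ⟨i, hi, hmax⟩ := exists_max_image (σ.support \ Z) d ⟨a, by simp_all⟩
  simp only [mem_sdiff, Equiv.Perm.mem_support] at hi hmax
  have hj : σ (σ⁻¹ i) ≠ σ⁻¹ i := by
    intro h
    rw [perm_apply_inv_apply] at h
    exact hi.1 (by conv_lhs => rw [h, perm_apply_inv_apply])
  have hfj := hσ _ hj
  rw [perm_apply_inv_apply] at hfj hj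
  by_cases hjZ : σ⁻¹ i ∈ Z
  · exact hi.2 (hZ _ hjZ _ hfj)
  · have := hmax (σ⁻¹ i) ⟨by rwa [perm_apply_inv_apply], hjZ⟩
    have := hd _ hjZ _ hfj
    omega

theorem det_successorMatrix_of_root {r : W} {d : W → ℕ} (hf : IsAntisymmetricMap f)
    (hr : f r = none) (hd : ∀ i ≠ r, ∀ j, f i = some j → d j < d i) :
    (successorMatrix φ f).det = 1 := by
  -- Transposing turns the factors `M (σ i) i` of the Leibniz formula into `M i (σ i)`, so that `σ`
  -- is compared with `f` row by row.
  rw [← Matrix.det_transpose, Matrix.det_apply', sum_eq_single 1]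
  · simpa using prod_successorMatrix_one hf
  · intro σ _ hσ
    simp only [Matrix.transpose_apply]
    by_cases h : ∀ i, σ i ≠ i → f i = some (σ i)
    · exfalso
      have hs := support_subset_of_decreasing (Z := {r}) (d := d) (by simp [hr]) (by simpa using hd) h
      apply hσ
      ext i
      by_contra hi
      have hi' := h i hi
      have : i = r := by simpa using hs (Equiv.Perm.mem_support.2 hi)
      simp [this, hr] at hi'
    · push Not at h
      obtain ⟨i, h1, h2⟩ := h
      rw [prod_successorMatrix_eq_zero h1 h2, mul_zero]
  · simp

/-- Only the identity and `σ` survive in the Leibniz formula: a permutation following `f` cannot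
move points off the cycle, and if it moves one point of the cycle it moves them all. -/
theorem det_successorMatrix_of_cycle {σ : Equiv.Perm W} {d : W → ℕ} (hσ : σ.IsCycle)
    (hf : IsAntisymmetricMap f) (hs : ∀ i ∈ σ.support, f i = some (σ i))
    (hd : ∀ i ∉ σ.support, ∀ j, f i = some j → d j < d i) :
    (successorMatrix φ f).det = 1 - ∏ i ∈ σ.support, φ (σ i) i := by
  have h1σ : (1 : Equiv.Perm W) ≠ σ := hσ.ne_one.symm
  rw [← Matrix.det_transpose, Matrix.det_apply', ← sum_subset (subset_univ {1, σ}),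
    sum_pair h1σ]
  · simp only [Matrix.transpose_apply]
    rw [sign_mul_prod_successorMatrix hσ hf hs, prod_successorMatrix_one hf]
    simp [sub_eq_add_neg]
  · intro τ _ hτ
    simp only [Matrix.transpose_apply]
    simp only [mem_insert, mem_singleton, not_or] at hτ
    by_cases h : ∀ i, τ i ≠ i → f i = some (τ i)
    · exfalso
      have hsub := support_subset_of_decreasing (Z := σ.support) (d := d)
        (fun i hi j hj => by
          rw [hs i hi, Option.some.injEq] at hj
          rw [← hj]
          exact Equiv.Perm.apply_mem_support.2 hi) hd h
      have key : ∀ i, τ i ≠ i → τ i = σ i := fun i hi => by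
        have := hs i (hsub (Equiv.Perm.mem_support.2 hi))
        rw [h i hi, Option.some.injEq] at this
        exact this
      obtain ⟨a, ha⟩ : ∃ a, τ a ≠ a := by
        by_contra! hcon
        exact hτ.1 (Equiv.ext hcon)
      -- If `τ` moves `y`, then `σ y = τ y`, and injectivity of `τ` shows that `τ` moves this point
      -- too.
      have hpow : ∀ n : ℕ, τ ((σ ^ n) a) ≠ (σ ^ n) a := by
        intro n
        induction n with
        | zero => simpa using ha
        | succ n ih =>
          rw [pow_succ', Equiv.Perm.mul_apply, ← key _ ih]
          exact fun hcon => ih (τ.injective hcon)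
      apply hτ.2
      ext i
      by_cases hi : σ i = i
      · by_contra hne
        exact Equiv.Perm.mem_support.1
          (hsub (Equiv.Perm.mem_support.2 (show τ i ≠ i by rwa [hi] at hne))) hi
      · have haσ : σ a ≠ a := Equiv.Perm.mem_support.1 (hsub (Equiv.Perm.mem_support.2 ha))
        obtain ⟨n, rfl⟩ := hσ.exists_pow_eq haσ hi
        exact key _ (hpow n)
    · push Not at h
      obtain ⟨i, h1, h2⟩ := h
      rw [prod_successorMatrix_eq_zero h1 h2, mul_zero]

end Determinants

/-! ### Counting edges, and orientations forced by connectedness. -/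

section Counting

variable {H : SimpleGraph W} {f : W → Option W}

/-- Two points giving the same edge would form a 2-cycle of `f`. The default value of `getD` plays
no role, since `f` is defined on the set considered. -/
theorem injOn_edge_of_isAntisymmetricMap (hf : IsAntisymmetricMap f) :
    Set.InjOn (fun i => s(i, (f i).getD i)) {i | (f i).isSome} := by
  intro i hi j hj h
  obtain ⟨a, ha⟩ := Option.isSome_iff_exists.1 hi
  obtain ⟨b, hb⟩ := Option.isSome_iff_exists.1 hj
  simp only [ha, hb, Option.getD_some, Sym2.eq_iff] at h
  rcases h with h | ⟨rfl, rfl⟩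
  · exact h.1
  · exact absurd hb (hf _ _ ha)

theorem SimpleGraph.IsOrientedBy.edgeFinset_eq [Fintype W] (h : H.IsOrientedBy f) :
    H.edgeFinset = ({i | (f i).isSome} : Finset W).image fun i => s(i, (f i).getD i) := by
  ext e
  induction e with | _ x y
  simp only [SimpleGraph.mem_edgeFinset, SimpleGraph.mem_edgeSet, mem_image, mem_filter, mem_univ,
    true_and]
  rw [h x y]
  constructor
  · rintro (h | h)
    · exact ⟨x, by simp [h]⟩
    · exact ⟨y, by simp [h, Sym2.eq_swap]⟩
  · rintro ⟨i, hi, he⟩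
    obtain ⟨a, ha⟩ := Option.isSome_iff_exists.1 hi
    simp only [ha, Option.getD_some, Sym2.eq_iff] at he
    rcases he with ⟨rfl, rfl⟩ | ⟨rfl, rfl⟩
    · exact Or.inl ha
    · exact Or.inr ha

theorem SimpleGraph.IsOrientedBy.card_edgeFinset [Fintype W] (h : H.IsOrientedBy f)
    (hf : IsAntisymmetricMap f) : #H.edgeFinset = #{i | (f i).isSome} := by
  rw [h.edgeFinset_eq, card_image_of_injOn]
  simpa using injOn_edge_of_isAntisymmetricMap hf

theorem SimpleGraph.IsOrientedBy.prod_edgeFinset [Fintype W] {M : Type*} [CommMonoid M]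
    (h : H.IsOrientedBy f) (hf : IsAntisymmetricMap f) (c : Sym2 W → M) :
    ∏ e ∈ H.edgeFinset, c e = ∏ i with (f i).isSome, c s(i, (f i).getD i) := by
  rw [h.edgeFinset_eq, prod_image]
  simpa using injOn_edge_of_isAntisymmetricMap hf

/-- The edges `{i, f i}` are distinct edges of `H`, so by cardinality they exhaust `H`. -/
theorem isOrientedBy_of_card_le [Fintype W] (hf : IsAntisymmetricMap f)
    (hadj : ∀ i j, f i = some j → H.Adj i j) (hcard : #H.edgeFinset ≤ #{i | (f i).isSome}) :
    H.IsOrientedBy f := by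
  have hsub : (({i | (f i).isSome} : Finset W).image fun i => s(i, (f i).getD i)) ⊆
      H.edgeFinset := by
    intro e he
    simp only [mem_image, mem_filter, mem_univ, true_and] at he
    obtain ⟨i, hi, rfl⟩ := he
    obtain ⟨a, ha⟩ := Option.isSome_iff_exists.1 hi
    simpa [ha] using hadj i a ha
  have heq := eq_of_subset_of_card_le hsub (by
    rw [card_image_of_injOn (by simpa using injOn_edge_of_isAntisymmetricMap hf)]
    exact hcard)
  intro i j
  constructor
  · intro h
    have he : s(i, j) ∈ H.edgeFinset := by simpa using h
    rw [← heq] at he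
    simp only [mem_image, mem_filter, mem_univ, true_and] at he
    obtain ⟨k, hk, he⟩ := he
    obtain ⟨a, ha⟩ := Option.isSome_iff_exists.1 hk
    simp only [ha, Option.getD_some, Sym2.eq_iff] at he
    rcases he with ⟨rfl, rfl⟩ | ⟨rfl, rfl⟩
    · exact Or.inl ha
    · exact Or.inr ha
  · rintro (h | h)
    · exact hadj i j h
    · exact (hadj j i h).symm

/-- In a connected graph every nonempty set of vertices can be approached step by step. -/
theorem SimpleGraph.Connected.exists_decreasing (hH : H.Connected) {Z : Finset W}
    (hZ : Z.Nonempty) :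
    ∃ (d : W → ℕ) (g : W → W), ∀ i ∉ Z, H.Adj i (g i) ∧ d (g i) < d i := by
  -- Here `d` is the distance to `Z`, and `g` will be the first step of a shortest walk to `Z`.
  let d : W → ℕ := fun i => Z.inf' hZ (H.dist i)
  have : ∀ i, ∃ j, i ∉ Z → H.Adj i j ∧ d j < d i := by
    intro i
    by_cases hi : i ∈ Z
    · exact ⟨i, fun h => absurd hi h⟩
    obtain ⟨z, hz, hdz⟩ := exists_mem_eq_inf' hZ (H.dist i)
    obtain ⟨p, hp⟩ := hH.exists_walk_length_eq_dist i z
    cases p with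
    | nil => exact absurd hz hi
    | @cons _ v _ h q =>
      refine ⟨v, fun _ => ⟨h, ?_⟩⟩
      have h1 : d v ≤ H.dist v z := inf'_le _ hz
      have h2 := H.dist_le q
      have h3 : d i = H.dist i z := hdz
      rw [SimpleGraph.Walk.length_cons] at hp
      omega
  choose g hg using this
  exact ⟨d, g, hg⟩

/-- An orientation which does not leave `Z` points towards `Z` outside of `Z`. -/
theorem SimpleGraph.IsOrientedBy.eq_of_decreasing (h : H.IsOrientedBy f) {Z : Finset W}
    {d : W → ℕ} {g : W → W} (hg : ∀ i ∉ Z, H.Adj i (g i) ∧ d (g i) < d i)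
    (hZ : ∀ i ∈ Z, ∀ j, f i = some j → j ∈ Z) {i : W} (hi : i ∉ Z) : f i = some (g i) := by
  induction hn : d i using Nat.strong_induction_on generalizing i with
  | _ n ih =>
    subst hn
    rcases (h _ _).1 (hg i hi).1 with h1 | h1
    · exact h1
    -- If the edge pointed from `g i` to `i`, then `g i` would lie outside `Z`, and induction would
    -- give `g (g i) = i`, although `d` drops at both steps.
    · exfalso
      by_cases hj : g i ∈ Z
      · exact hi (hZ _ hj _ h1)
      · have := ih _ (hg i hi).2 hj rfl
        rw [h1, Option.some.injEq] at this
        have h2 := (hg _ hj).2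
        rw [← this] at h2
        have h3 := (hg i hi).2
        omega

end Counting

/-- The partial map which is `h` on `Z` and `g` outside of `Z`. -/
noncomputable def extendOutside (Z : Finset W) (h : W → Option W) (g : W → W) (i : W) : Option W :=
  if i ∈ Z then h i else some (g i)

theorem isAntisymmetricMap_extendOutside {Z : Finset W} {h : W → Option W} {d : W → ℕ} {g : W → W}
    (hg : ∀ i ∉ Z, d (g i) < d i) (hZ : ∀ i ∈ Z, ∀ j, h i = some j → j ∈ Z ∧ h j ≠ some i) :
    IsAntisymmetricMap (extendOutside Z h g) := by
  intro i j hij hji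
  simp only [extendOutside] at hij hji
  split_ifs at hij hji with h1 h2 h2
  · exact (hZ i h1 j hij).2 hji
  · exact h2 (hZ i h1 j hij).1
  · exact h1 (hZ j h2 i hji).1
  · rw [Option.some.injEq] at hij hji
    have h3 := hg i h1
    have h4 := hg j h2
    rw [hij] at h3
    rw [hji] at h4
    omega

/-! ### Orientation sums of trees, unicycles and other connected graphs. -/

section OrientationSums

variable {R : Type*} [CommRing R] [Fintype W] {φ : W → W → R} {H : SimpleGraph W}

theorem orientationSum_eq_sum_antisymmetric (hφ : ∀ i j, H.Adj i j → φ i j * φ j i = 1) :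
    orientationSum φ H =
      ∑ f : W → Option W with H.IsOrientedBy f ∧ IsAntisymmetricMap f,
        (successorMatrix φ f).det := by
  symm
  refine sum_subset (fun f hf => by simp_all) fun f hf hf' => ?_
  simp only [mem_filter, mem_univ, true_and] at hf hf'
  have h := fun h => hf' ⟨hf, h⟩
  simp only [imp_false, IsAntisymmetricMap] at h
  push Not at h
  obtain ⟨i, j, hi, hj⟩ := h
  have hadj := (hf i j).2 (Or.inl hi)
  exact det_successorMatrix_eq_zero_of_two_cycle hadj.ne hi hj (hφ i j hadj)

/-- Having one edge fewer than vertices, a tree forces `f` to be undefined at some root; all edges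
then point towards it. Conversely each root gives one orientation. -/
theorem orientationSum_of_isTree (hφ : ∀ i j, H.Adj i j → φ i j * φ j i = 1) (hH : H.IsTree) :
    orientationSum φ H = Fintype.card W := by
  have hcon := hH.1
  have hcard : #H.edgeFinset + 1 = Fintype.card W := hH.card_edgeFinset
  choose d g hg using fun r : W => hcon.exists_decreasing (singleton_nonempty r)
  let F : W → W → Option W := fun r => extendOutside {r} (fun _ => none) (g r)
  have hFr : ∀ r, F r r = none := fun r => by simp [F, extendOutside]
  have hFi : ∀ r i, i ≠ r → F r i = some (g r i) := fun r i hi => by simp [F, extendOutside, hi]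
  have hanti : ∀ r, IsAntisymmetricMap (F r) := fun r =>
    isAntisymmetricMap_extendOutside (fun i hi => (hg r i hi).2) (by simp)
  have hor : ∀ r, H.IsOrientedBy (F r) := by
    intro r
    refine isOrientedBy_of_card_le (hanti r) (fun i j hij => ?_) ?_
    · rcases eq_or_ne i r with rfl | hi
      · simp [hFr] at hij
      · rw [hFi r i hi, Option.some.injEq] at hij
        exact hij ▸ (hg r i (by simpa using hi)).1
    · have : ({i | (F r i).isSome} : Finset W) = univ.erase r := by
        ext i
        rcases eq_or_ne i r with rfl | hi
        · simp [hFr]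
        · simp [hFi r i hi, hi]
      rw [this, card_erase_of_mem (mem_univ r), card_univ]
      omega
  rw [orientationSum_eq_sum_antisymmetric hφ, Fintype.card_eq_sum_ones, Nat.cast_sum]
  symm
  refine sum_bij (fun r _ => F r) (fun r _ => by simp [hor r, hanti r]) ?_ ?_ ?_
  · intro r _ s _ hrs
    by_contra hne
    have := congrFun hrs r
    rw [hFr, hFi s r hne] at this
    simp at this
  · intro f hf
    simp only [mem_filter, mem_univ, true_and] at hf
    have h1 := hf.1.card_edgeFinset hf.2
    have h2 : #{i | (f i).isSome} < #(univ : Finset W) := by rw [card_univ]; omega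
    obtain ⟨r, -, hr⟩ := exists_mem_notMem_of_card_lt_card h2
    have hr : f r = none := by simpa using hr
    refine ⟨r, mem_univ r, funext fun i => ?_⟩
    rcases eq_or_ne i r with rfl | hi
    · rw [hFr, hr]
    · rw [hFi r i hi]
      exact (hf.1.eq_of_decreasing (hg r) (by simp [hr]) (by simpa using hi)).symm
  · intro r _
    rw [det_successorMatrix_of_root (d := d r) (hanti r) (hFr r)]
    · simp
    · intro i hi j hij
      rw [hFi r i hi, Option.some.injEq] at hij
      exact hij ▸ (hg r i (by simpa using hi)).2

/-- The edges of an antisymmetric orientation are counted by the points where `f` is defined, so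
there are at most `|W|` of them; connectedness requires at least `|W| - 1`. -/
theorem orientationSum_eq_zero (hφ : ∀ i j, H.Adj i j → φ i j * φ j i = 1) (hH : H.Connected)
    (h1 : ¬ H.IsTree) (h2 : ¬ H.IsUnicycle) : orientationSum φ H = 0 := by
  rw [orientationSum_eq_sum_antisymmetric hφ]
  refine sum_eq_zero fun f hf => ?_
  exfalso
  simp only [mem_filter, mem_univ, true_and] at hf
  have h3 := hf.1.card_edgeFinset hf.2
  have h4 := hH.card_vert_le_card_edgeSet_add_one
  have h5 := card_le_univ ({i | (f i).isSome} : Finset W)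
  have h6 : Nat.card H.edgeSet = #H.edgeFinset := by
    rw [Nat.card_eq_fintype_card, SimpleGraph.edgeFinset_card]
  rw [SimpleGraph.isTree_iff_connected_and_card] at h1
  have h7 : Nat.card H.edgeSet + 1 ≠ Nat.card W := fun h => h1 ⟨hH, h⟩
  have h8 : Nat.card H.edgeSet ≠ Nat.card W := fun h => h2 ⟨hH, h⟩
  rw [Nat.card_eq_fintype_card (α := W)] at *
  omega

/-- The cyclic permutation of the vertices of a cycle in a graph. -/
theorem SimpleGraph.Walk.IsCycle.exists_perm {u : W} {p : H.Walk u u} (hp : p.IsCycle)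
    (ψ : W → W → R) :
    ∃ σ : Equiv.Perm W, σ.IsCycle ∧ (∀ i ∈ σ.support, H.Adj i (σ i) ∧ σ (σ i) ≠ i) ∧
      (p.darts.map fun d => ψ d.fst d.snd).prod = ∏ i ∈ σ.support, ψ i (σ i) := by
  -- The base point occurs at both ends of the support; dropping the last entry leaves each vertex
  -- of the cycle once.
  set l := p.support.dropLast with hl
  have hnd : l.Nodup := hp.nodup_dropLast_support
  have hlen : l.length = p.length := by simp [hl]
  have h3 := hp.three_le_length
  have hget : ∀ (n : ℕ) (hn : n < l.length), l[n] = p.getVert n := by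
    intro n hn
    rw [p.getVert_eq_support_getElem (by omega)]
    simp [hl]
  have hσ : ∀ (n : ℕ) (hn : n < l.length), l.formPerm l[n] = p.getVert (n + 1) := by
    intro n hn
    rw [List.formPerm_apply_getElem _ hnd, hget]
    rcases Nat.lt_or_ge (n + 1) l.length with h | h
    · rw [Nat.mod_eq_of_lt h]
    · have : n + 1 = l.length := by omega
      rw [this, Nat.mod_self, hlen]
      simp
  have hsupp : l.formPerm.support = l.toFinset := by
    refine List.support_formPerm_of_nodup l hnd fun x hx => ?_
    rw [hx] at hlen
    simp at hlen
    omega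
  have hdart : ∀ d ∈ p.darts, l.formPerm d.fst = d.snd := by
    intro d hd
    obtain ⟨n, hn, rfl⟩ := List.getElem_of_mem hd
    have hn' : n < l.length := by simpa [hlen] using hn
    have h1 : p.darts[n].fst = l[n] := by
      simp only [hl, ← p.map_fst_darts, List.getElem_map]
    rw [h1, hσ n hn', p.snd_darts_getElem hn, p.getVert_eq_support_getElem (by omega)]
    simp
  refine ⟨l.formPerm, List.isCycle_formPerm hnd (by omega), fun i hi => ?_, ?_⟩
  · rw [hsupp, List.mem_toFinset] at hi
    constructor
    · rw [hl, ← p.map_fst_darts, List.mem_map] at hi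
      obtain ⟨d, hd, rfl⟩ := hi
      rw [hdart d hd]
      exact d.adj
    -- A cycle has length at least three, so advancing by two positions never returns to the start.
    · obtain ⟨n, hn, rfl⟩ := List.getElem_of_mem hi
      rw [List.formPerm_apply_getElem _ hnd, List.formPerm_apply_getElem _ hnd, Ne,
        hnd.getElem_inj_iff, Nat.mod_add_mod]
      intro h
      rcases Nat.lt_or_ge (n + 1 + 1) l.length with h' | h'
      · rw [Nat.mod_eq_of_lt h'] at h; omega
      · rw [Nat.mod_eq_sub_mod h', Nat.mod_eq_of_lt (by omega)] at h; omega
  · have h1 : (l.map fun i => ψ i (l.formPerm i)) = p.darts.map fun d => ψ d.fst d.snd := by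
      conv_lhs => arg 2; rw [hl, ← p.map_fst_darts]
      rw [List.map_map]
      exact List.map_congr_left fun d hd => congrArg _ (hdart d hd)
    rw [hsupp, List.prod_toFinset _ hnd, h1]

/-- An orientation without 2-cycles follows a cycle of the graph in one of its two directions. -/
theorem SimpleGraph.IsOrientedBy.forall_support {f : W → Option W} (h : H.IsOrientedBy f)
    {σ : Equiv.Perm W} (hσ : σ.IsCycle)
    (hadj : ∀ i ∈ σ.support, H.Adj i (σ i) ∧ σ (σ i) ≠ i) :
    (∀ i ∈ σ.support, f i = some (σ i)) ∨ ∀ i ∈ σ.support, f i = some (σ⁻¹ i) := by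
  by_cases hx : ∃ x ∈ σ.support, f x = some (σ x)
  · left
    obtain ⟨x, hx, hfx⟩ := hx
    -- The direction propagates backwards along the cycle: `f (σ y)` is already `σ (σ y)`, which
    -- differs from `y`, so the edge between `y` and `σ y` must leave `y`.
    have step : ∀ y ∈ σ.support, f (σ y) = some (σ (σ y)) → f y = some (σ y) := by
      intro y hy hfy
      rcases (h _ _).1 (hadj y hy).1 with h1 | h1
      · exact h1
      · rw [hfy, Option.some.injEq] at h1
        exact absurd h1 (hadj y hy).2
    intro i hi
    obtain ⟨n, hn⟩ := hσ.exists_pow_eq (Equiv.Perm.mem_support.1 hi) (Equiv.Perm.mem_support.1 hx)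
    clear * - hn hfx hi step
    induction n generalizing i with
    | zero => simp at hn; rwa [hn]
    | succ n ih =>
      exact step i hi (ih (σ i) (Equiv.Perm.apply_mem_support.2 hi)
        (by rwa [pow_succ, Equiv.Perm.mul_apply] at hn))
  · right
    push Not at hx
    intro i hi
    have hi' : σ⁻¹ i ∈ σ.support := by
      rw [← Equiv.Perm.apply_mem_support, perm_apply_inv_apply]
      exact hi
    have := (h _ _).1 (hadj _ hi').1
    rw [perm_apply_inv_apply] at this
    refine this.resolve_left fun h' => hx _ hi' ?_
    rw [h', perm_apply_inv_apply]

/-- An antisymmetric orientation runs along the cycle as `σ` or as `σ⁻¹`; off the cycle every edge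
is forced to point towards it. Both choices do orient `H`, because it has as many edges as vertices.
-/
theorem orientationSum_of_isUnicycle (hφ : ∀ i j, H.Adj i j → φ i j * φ j i = 1)
    (hH : H.IsUnicycle) {σ : Equiv.Perm W} (hσ : σ.IsCycle)
    (hadj : ∀ i ∈ σ.support, H.Adj i (σ i) ∧ σ (σ i) ≠ i) :
    orientationSum φ H =
      (1 - ∏ i ∈ σ.support, φ i (σ i)) + (1 - ∏ i ∈ σ.support, φ (σ i) i) := by
  obtain ⟨hcon, hcard⟩ := hH
  have hcard : #H.edgeFinset = Fintype.card W := by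
    rwa [Nat.card_eq_fintype_card, Nat.card_eq_fintype_card, ← SimpleGraph.edgeFinset_card] at hcard
  have hne : σ.support.Nonempty := by
    obtain ⟨x, hx, -⟩ := hσ
    exact ⟨x, Equiv.Perm.mem_support.2 hx⟩
  obtain ⟨d, g, hg⟩ := hcon.exists_decreasing hne
  let F : Equiv.Perm W → W → Option W := fun τ =>
    extendOutside σ.support (fun i => some (τ i)) g
  have hFs : ∀ τ, ∀ i ∈ σ.support, F τ i = some (τ i) := fun τ i hi => by
    simp only [F, extendOutside, if_pos hi]
  have hFi : ∀ τ, ∀ i ∉ σ.support, F τ i = some (g i) := fun τ i hi => by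
    simp only [F, extendOutside, if_neg hi]
  have hsome : ∀ τ i, (F τ i).isSome := fun τ i => by
    by_cases hi : i ∈ σ.support
    · simp [hFs τ i hi]
    · simp [hFi τ i hi]
  have hmem : ∀ i ∈ σ.support, σ⁻¹ i ∈ σ.support := fun i hi => by
    rw [← Equiv.Perm.apply_mem_support, perm_apply_inv_apply]
    exact hi
  have hanti : ∀ τ : Equiv.Perm W, (∀ i ∈ σ.support, τ i ∈ σ.support ∧ τ (τ i) ≠ i) →
      IsAntisymmetricMap (F τ) := fun τ hτ =>
    isAntisymmetricMap_extendOutside (fun i hi => (hg i hi).2) fun i hi j hij => by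
      rw [Option.some.injEq] at hij
      subst hij
      simpa using hτ i hi
  have hor : ∀ τ : Equiv.Perm W, (∀ i ∈ σ.support, τ i ∈ σ.support ∧ τ (τ i) ≠ i) →
      (∀ i ∈ σ.support, H.Adj i (τ i)) → H.IsOrientedBy (F τ) := by
    intro τ hτ hτ'
    refine isOrientedBy_of_card_le (hanti τ hτ) (fun i j hij => ?_) ?_
    · by_cases hi : i ∈ σ.support
      · rw [hFs τ i hi, Option.some.injEq] at hij
        exact hij ▸ hτ' i hi
      · rw [hFi τ i hi, Option.some.injEq] at hij
        exact hij ▸ (hg i hi).1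
    · simp [hsome, hcard]
  have hτ1 : ∀ i ∈ σ.support, σ i ∈ σ.support ∧ σ (σ i) ≠ i := fun i hi =>
    ⟨Equiv.Perm.apply_mem_support.2 hi, (hadj i hi).2⟩
  have hτ2 : ∀ i ∈ σ.support, σ⁻¹ i ∈ σ.support ∧ σ⁻¹ (σ⁻¹ i) ≠ i := fun i hi => by
    refine ⟨hmem i hi, fun h => (hadj i hi).2 ?_⟩
    conv_lhs => rw [← h]
    simp
  have hadj1 : ∀ i ∈ σ.support, H.Adj i (σ i) := fun i hi => (hadj i hi).1
  have hadj2 : ∀ i ∈ σ.support, H.Adj i (σ⁻¹ i) := fun i hi => by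
    simpa using (hadj _ (hmem i hi)).1.symm
  have hdet : ∀ τ : Equiv.Perm W, τ.IsCycle → τ.support = σ.support →
      (∀ i ∈ σ.support, τ i ∈ σ.support ∧ τ (τ i) ≠ i) →
      (successorMatrix φ (F τ)).det = 1 - ∏ i ∈ τ.support, φ (τ i) i := by
    intro τ hc hs hτ
    refine det_successorMatrix_of_cycle (d := d) hc (hanti τ hτ) (by rw [hs]; exact hFs τ) ?_
    rw [hs]
    intro i hi j hij
    rw [hFi τ i hi, Option.some.injEq] at hij
    exact hij ▸ (hg i hi).2
  have hset : ({f : W → Option W | H.IsOrientedBy f ∧ IsAntisymmetricMap f} : Finset _) =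
      {F σ⁻¹, F σ} := by
    ext f
    simp only [mem_filter, mem_univ, true_and, mem_insert, mem_singleton]
    constructor
    · rintro ⟨hf, -⟩
      rcases hf.forall_support hσ hadj with h | h
      · right
        funext i
        by_cases hi : i ∈ σ.support
        · rw [h i hi, hFs _ i hi]
        · rw [hFi _ i hi]
          refine hf.eq_of_decreasing hg (fun i hi j hij => ?_) hi
          rw [h i hi, Option.some.injEq] at hij
          exact hij ▸ (hτ1 i hi).1
      · left
        funext i
        by_cases hi : i ∈ σ.support
        · rw [h i hi, hFs _ i hi]
        · rw [hFi _ i hi]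
          refine hf.eq_of_decreasing hg (fun i hi j hij => ?_) hi
          rw [h i hi, Option.some.injEq] at hij
          exact hij ▸ (hτ2 i hi).1
    · rintro (rfl | rfl)
      · exact ⟨hor _ hτ2 hadj2, hanti _ hτ2⟩
      · exact ⟨hor _ hτ1 hadj1, hanti _ hτ1⟩
  have hFne : F σ⁻¹ ≠ F σ := by
    obtain ⟨x, hx⟩ := hne
    intro h
    have := congrFun h x
    rw [hFs _ x hx, hFs _ x hx, Option.some.injEq] at this
    apply (hadj x hx).2
    rw [← this]
    simp
  rw [orientationSum_eq_sum_antisymmetric hφ, hset, sum_pair hFne,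
    hdet σ hσ rfl hτ1, hdet σ⁻¹ hσ.inv (Equiv.Perm.support_inv σ) hτ2, Equiv.Perm.support_inv]
  -- The product for `σ⁻¹` is reindexed by `i ↦ σ⁻¹ i`.
  congr 2
  refine prod_bij (fun i _ => σ⁻¹ i) (fun i hi => hmem i hi) (fun i _ j _ h => by simpa using h)
    (fun i hi => ⟨σ i, (hτ1 i hi).1, by simp⟩) (fun i _ => by simp)

theorem orientationSum_of_isUnicycle_eq_holonomy {K : Type*} [Field K] {φ : W → W → K}
    (hφ : ∀ i j, H.Adj i j → φ i j * φ j i = 1) (hH : H.IsUnicycle) {u : W} {p : H.Walk u u}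
    (hp : p.IsCycle) {w : K} (hw : (p.darts.map fun d => φ d.fst d.snd).prod = w) :
    orientationSum φ H = (1 - w) * (1 - 1 / w) := by
  obtain ⟨σ, hσ, hadj, hprod⟩ := hp.exists_perm φ
  rw [hprod] at hw
  have hinv : w * ∏ i ∈ σ.support, φ (σ i) i = 1 := by
    rw [← hw, ← prod_mul_distrib]
    exact prod_eq_one fun i hi => hφ i (σ i) (hadj i hi).1
  have hne : w ≠ 0 := left_ne_zero_of_mul_eq_one hinv
  rw [orientationSum_of_isUnicycle hφ hH hσ hadj, hw, eq_one_div_of_mul_eq_one_right hinv]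
  field_simp
  ring

end OrientationSums

end OrientedGraphs

/-! ### Factorization over connected components. -/

section Components

open scoped Classical
open Finset

variable {V : Type*} {H : SimpleGraph V}

/-- The partial map on all vertices assembled from partial maps on the connected components. -/
noncomputable def glueComponents (p : ∀ C : H.ConnectedComponent, C → Option C) (v : V) :
    Option V :=
  (p (H.connectedComponentMk v) ⟨v, rfl⟩).map Subtype.val

theorem glueComponents_apply (p : ∀ C : H.ConnectedComponent, C → Option C)
    {C : H.ConnectedComponent} (v : C) : glueComponents p v = (p C v).map Subtype.val := by
  obtain ⟨v, hv⟩ := v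
  obtain rfl : H.connectedComponentMk v = C := hv
  rfl

theorem glueComponents_eq_some_iff (p : ∀ C : H.ConnectedComponent, C → Option C)
    {C : H.ConnectedComponent} (v w : C) : glueComponents p v = some w.1 ↔ p C v = some w := by
  rw [glueComponents_apply, Option.map_eq_some_iff]
  constructor
  · rintro ⟨a, ha, h⟩
    rw [ha, Subtype.ext h]
  · exact fun h => ⟨w, h, rfl⟩

theorem connectedComponentMk_eq_of_glueComponents_eq_some
    {p : ∀ C : H.ConnectedComponent, C → Option C} {v w : V} (h : glueComponents p v = some w) :
    H.connectedComponentMk w = H.connectedComponentMk v := by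
  rw [glueComponents, Option.map_eq_some_iff] at h
  obtain ⟨a, -, rfl⟩ := h
  exact a.2

theorem isOrientedBy_glueComponents_iff {p : ∀ C : H.ConnectedComponent, C → Option C} :
    H.IsOrientedBy (glueComponents p) ↔
      ∀ C : H.ConnectedComponent, C.toSimpleGraph.IsOrientedBy (p C) := by
  constructor
  · intro h C i j
    rw [← glueComponents_eq_some_iff, ← glueComponents_eq_some_iff]
    exact h i j
  · intro h i j
    by_cases hij : H.connectedComponentMk j = H.connectedComponentMk i
    · have := h (H.connectedComponentMk i) ⟨i, rfl⟩ ⟨j, hij⟩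
      rw [← glueComponents_eq_some_iff, ← glueComponents_eq_some_iff] at this
      exact this
    · constructor
      · exact fun hadj => absurd (SimpleGraph.ConnectedComponent.sound hadj.reachable).symm hij
      · rintro (h' | h')
        · exact absurd (connectedComponentMk_eq_of_glueComponents_eq_some h') hij
        · exact absurd (connectedComponentMk_eq_of_glueComponents_eq_some h').symm hij

/-- Since `{v, f v}` is an edge of `H`, an orientation never leaves a component. -/
theorem exists_glueComponents_eq {f : V → Option V} (hf : H.IsOrientedBy f) :
    ∃ p : ∀ C : H.ConnectedComponent, C → Option C, glueComponents p = f := by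
  have : ∀ v : V, ∃ o : Option (H.connectedComponentMk v), o.map Subtype.val = f v := by
    intro v
    cases hv : f v with
    | none => exact ⟨none, rfl⟩
    | some w =>
      have hadj := (hf v w).2 (Or.inl hv)
      exact ⟨some ⟨w, (SimpleGraph.ConnectedComponent.sound hadj.reachable).symm⟩, rfl⟩
  choose o ho using this
  refine ⟨fun C v => (o v.1).map fun w => ⟨w.1, w.2.trans v.2⟩, funext fun v => ?_⟩
  rw [← ho v, glueComponents, Option.map_map]
  rfl

theorem glueComponents_injective :
    Function.Injective (glueComponents : (∀ C : H.ConnectedComponent, C → Option C) → _) := by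
  intro p q h
  funext C v
  have := congrFun h v.1
  rw [glueComponents_apply, glueComponents_apply] at this
  exact Option.map_injective Subtype.val_injective this

variable [Fintype V] {R : Type*} [CommRing R]

theorem det_successorMatrix_glueComponents (φ : V → V → R)
    (p : ∀ C : H.ConnectedComponent, C → Option C) :
    (successorMatrix φ (glueComponents p)).det =
      ∏ C : H.ConnectedComponent, (successorMatrix (fun i j : C => φ i j) (p C)).det := by
  -- Any linear order on the components will do: the matrix has no entries between different
  -- components, so it is block triangular for each of them.
  let e := Fintype.equivFin H.ConnectedComponent
  let _ : LinearOrder H.ConnectedComponent := LinearOrder.lift' e e.injective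
  have hblock : (successorMatrix φ (glueComponents p)).BlockTriangular H.connectedComponentMk := by
    intro i j hij
    have h1 : i ≠ j := fun h => hij.ne (by rw [h])
    have h2 : glueComponents p i ≠ some j := fun h =>
      hij.ne (connectedComponentMk_eq_of_glueComponents_eq_some h)
    simp [successorMatrix, h1, h2]
  have hdet := hblock.det_fintype
  convert hdet using 2 with C
  let e' : C ≃ {v // H.connectedComponentMk v = C} := Equiv.refl _
  rw [← Matrix.det_submatrix_equiv_self e']
  congr 1
  ext i j
  have h1 : (i = j) = ((i : V) = j) := propext Subtype.ext_iff
  have h2 : (p C i = some j) = (glueComponents p i = some j.1) :=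
    propext (glueComponents_eq_some_iff p i j).symm
  simp only [successorMatrix, Matrix.of_apply, h1, h2]
  rfl

theorem orientationSum_eq_prod (φ : V → V → R) (H : SimpleGraph V) :
    orientationSum φ H =
      ∏ C : H.ConnectedComponent, orientationSum (fun i j : C => φ i j) C.toSimpleGraph := by
  simp only [orientationSum]
  rw [prod_univ_sum]
  symm
  refine sum_bij (fun p _ => glueComponents p) ?_ (fun _ _ _ _ h => glueComponents_injective h)
    ?_ ?_
  · intro p hp
    simpa [isOrientedBy_glueComponents_iff] using hp
  · intro f hf
    simp only [mem_filter, mem_univ, true_and] at hf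
    obtain ⟨p, rfl⟩ := exists_glueComponents_eq hf
    exact ⟨p, by simpa [isOrientedBy_glueComponents_iff] using hf, rfl⟩
  · intro p _
    rw [det_successorMatrix_glueComponents]
    refine prod_congr rfl fun C _ => ?_
    congr

theorem sum_card_component (H : SimpleGraph V) :
    ∑ C : H.ConnectedComponent, Fintype.card C = Fintype.card V := by
  rw [← Fintype.card_sigma]
  exact Fintype.card_congr (Equiv.sigmaFiberEquiv H.connectedComponentMk)

theorem degree_toSimpleGraph (C : H.ConnectedComponent) (v : C) :
    C.toSimpleGraph.degree v = H.degree v := by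
  rw [← SimpleGraph.card_neighborFinset_eq_degree, ← SimpleGraph.card_neighborFinset_eq_degree]
  refine card_bij (fun w _ => w.1) ?_ (fun _ _ _ _ h => Subtype.ext h) ?_
  · intro w hw
    rw [SimpleGraph.mem_neighborFinset] at hw ⊢
    exact hw
  · intro w hw
    rw [SimpleGraph.mem_neighborFinset] at hw
    refine ⟨⟨w, (SimpleGraph.ConnectedComponent.sound hw.reachable).symm.trans v.2⟩, ?_, rfl⟩
    rw [SimpleGraph.mem_neighborFinset]
    exact hw

/-- By the handshake lemma it suffices to add up degrees, which are the same in a component as in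
`H`. -/
theorem sum_card_edgeSet_component (H : SimpleGraph V) :
    ∑ C : H.ConnectedComponent, Nat.card C.toSimpleGraph.edgeSet = Nat.card H.edgeSet := by
  have h1 : ∀ C : H.ConnectedComponent, 2 * Nat.card C.toSimpleGraph.edgeSet =
      ∑ v : C, H.degree (v : V) := fun C => by
    rw [Nat.card_eq_fintype_card, ← SimpleGraph.edgeFinset_card,
      ← SimpleGraph.sum_degrees_eq_twice_card_edges]
    exact sum_congr rfl fun v _ => degree_toSimpleGraph C v
  have h2 : 2 * Nat.card H.edgeSet = ∑ v, H.degree v := by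
    rw [Nat.card_eq_fintype_card, ← SimpleGraph.edgeFinset_card,
      ← SimpleGraph.sum_degrees_eq_twice_card_edges]
  refine Nat.eq_of_mul_eq_mul_left two_pos ?_
  rw [mul_sum, h2, sum_congr rfl fun C _ => h1 C]
  exact Fintype.sum_fiberwise H.connectedComponentMk fun v => H.degree v

theorem SimpleGraph.IsTree.not_isUnicycle {W : Type*} [Finite W] {T : SimpleGraph W}
    (hT : T.IsTree) : ¬ T.IsUnicycle := by
  intro h
  have h1 := (SimpleGraph.isTree_iff_connected_and_card.1 hT).2
  have h2 := h.2
  omega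

/-- Vertices minus edges is 1 for a tree and 0 for a unicycle. -/
theorem SimpleGraph.IsMixedForest.card_trees_add_card_edgeSet (hH : H.IsMixedForest) :
    Nat.card {C : H.ConnectedComponent // C.toSimpleGraph.IsTree} + Nat.card H.edgeSet =
      Fintype.card V := by
  rw [← sum_card_edgeSet_component, ← sum_card_component H, Nat.card_eq_fintype_card,
    Fintype.card_subtype, card_filter, ← sum_add_distrib]
  refine sum_congr rfl fun C _ => ?_
  rw [← Nat.card_eq_fintype_card]
  rcases hH C with h | h
  · rw [if_pos h, ← (SimpleGraph.isTree_iff_connected_and_card.1 h).2, add_comm]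
  · rw [if_neg fun hT => hT.not_isUnicycle h, h.2, zero_add]

end Components

/-! ### Expansion of the characteristic polynomial. -/

namespace LineBundleConnection

open scoped Classical
open Finset Polynomial

variable {V : Type*} {G : SimpleGraph V} {K : Type*} [Field K]

theorem mul_symm (Φ : LineBundleConnection G K) {i j : V} (h : G.Adj i j) :
    Φ.φ i j * Φ.φ j i = 1 := by
  rw [Φ.symm_eq_inv i j h, mul_inv_cancel₀ (Φ.ne_zero i j h)]

theorem transport_map_toSimpleGraph_hom (Φ : LineBundleConnection G K) {H : SimpleGraph V}
    {C : H.ConnectedComponent} {u v : C} (q : C.toSimpleGraph.Walk u v) :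
    Φ.transport (q.map C.toSimpleGraph_hom) = (q.darts.map fun d => Φ.φ d.fst d.snd).prod := by
  unfold transport
  rw [SimpleGraph.Walk.darts_map, List.map_map]
  rfl

variable [Fintype V]

theorem orientationSum_component_of_isUnicycle (Φ : LineBundleConnection G K) {H : SimpleGraph V}
    (hHG : H ≤ G) (C : H.ConnectedComponent) (hC : C.toSimpleGraph.IsUnicycle) :
    orientationSum (fun i j : C => Φ.φ i j) C.toSimpleGraph =
      (1 - Φ.holonomy C hC) * (1 - 1 / Φ.holonomy C hC) := by
  obtain ⟨v, hv, p, hp, hw⟩ : ∃ (v : V) (_ : v ∈ C) (p : H.Walk v v), p.IsCycle ∧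
      Φ.holonomy C hC = Φ.transport p :=
    have h := SimpleGraph.ConnectedComponent.exists_cycle_of_isUnicycle hC
    ⟨h.choose, h.choose_spec.choose, h.choose_spec.choose_spec.choose,
      h.choose_spec.choose_spec.choose_spec, rfl⟩
  -- The chosen cycle starts in `C` and hence stays there, so it is the image of a cycle of
  -- `C.toSimpleGraph`.
  have hmem : ∀ x ∈ p.support, x ∈ C.supp := fun x hx =>
    (SimpleGraph.ConnectedComponent.sound (p.takeUntil x hx).reachable).symm.trans hv
  obtain ⟨q, rfl⟩ : ∃ q : C.toSimpleGraph.Walk ⟨v, hv⟩ ⟨v, hv⟩, q.map C.toSimpleGraph_hom = p :=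
    ⟨p.induce C.supp hmem, p.map_induce hmem⟩
  refine orientationSum_of_isUnicycle_eq_holonomy (H := C.toSimpleGraph)
    (φ := fun i j : C => Φ.φ i j) (fun i j hij => Φ.mul_symm (hHG hij)) hC hp.of_map ?_
  rw [hw]
  exact (Φ.transport_map_toSimpleGraph_hom q).symm

theorem orientationSum_eq_zero_of_not_isMixedForest (Φ : LineBundleConnection G K)
    {H : SimpleGraph V} (hHG : H ≤ G) (hH : ¬ H.IsMixedForest) : orientationSum Φ.φ H = 0 := by
  simp only [SimpleGraph.IsMixedForest, not_forall, not_or] at hH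
  obtain ⟨C, h1, h2⟩ := hH
  rw [orientationSum_eq_prod]
  exact prod_eq_zero (mem_univ C) (orientationSum_eq_zero
    (fun i j hij => Φ.mul_symm (hHG hij)) C.connected_toSimpleGraph h1 h2)

theorem forestWeight_eq (Φ : LineBundleConnection G K) (c : Sym2 V → K)
    {H : SimpleGraph V} (hHG : H ≤ G) (hH : H.IsMixedForest) :
    Φ.forestWeight c H = (∏ e ∈ H.edgeFinset, c e) * orientationSum Φ.φ H := by
  have hφ : ∀ (C : H.ConnectedComponent) (i j : C), C.toSimpleGraph.Adj i j →
      Φ.φ i j * Φ.φ j i = 1 := fun C i j hij => Φ.mul_symm (hHG hij)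
  rw [forestWeight, mul_assoc, orientationSum_eq_prod,
    ← Fintype.prod_subtype_mul_prod_subtype fun C : H.ConnectedComponent => C.toSimpleGraph.IsTree]
  congr 2
  · refine prod_congr rfl fun C _ => ?_
    rw [orientationSum_of_isTree (hφ C.1) C.2, ← Nat.card_eq_fintype_card,
      ← (SimpleGraph.isTree_iff_connected_and_card.1 C.2).2]
    push_cast
    rfl
  · have hiff : ∀ C : H.ConnectedComponent,
        C.toSimpleGraph.IsUnicycle ↔ ¬ C.toSimpleGraph.IsTree := fun C =>
      ⟨fun h hT => hT.not_isUnicycle h, fun h => (hH C).resolve_left h⟩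
    refine Fintype.prod_equiv (Equiv.subtypeEquivRight hiff) _ _ fun C => ?_
    exact (Φ.orientationSum_component_of_isUnicycle hHG C.1 C.2).symm

/-- The coefficient with which the row `e_i - φ_{ji} e_j`, or `e_i`, occurs in row `i` of the
characteristic matrix of the Laplacian. -/
noncomputable def rowCoeff (G : SimpleGraph V) (c : Sym2 V → K) (i : V) (o : Option V) : K[X] :=
  o.elim X fun j => if G.Adj i j then -C (c s(i, j)) else 0

theorem toMatrix'_laplacian_apply (Φ : LineBundleConnection G K) (c : Sym2 V → K) (i k : V) :
    LinearMap.toMatrix' (Φ.laplacian c) i k = ∑ j with G.Adj i j,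
      c s(i, j) * ((if i = k then 1 else 0) - if j = k then Φ.φ j i else 0) := by
  rw [LinearMap.toMatrix'_apply]
  refine sum_congr rfl fun j _ => ?_
  simp [Pi.single_apply, eq_comm]

theorem charpoly_laplacian_eq_sum (Φ : LineBundleConnection G K) (c : Sym2 V → K) :
    (Φ.laplacian c).charpoly = ∑ f : V → Option V,
      (∏ i, rowCoeff G c i (f i)) * C (successorMatrix Φ.φ f).det := by
  rw [← LinearMap.charpoly_toMatrix _ (Pi.basisFun K V), LinearMap.toMatrix_eq_toMatrix',
    Matrix.charpoly]
  let row : V → Option V → V → K[X] := fun i o k =>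
    C ((if i = k then 1 else 0) - if o = some k then Φ.φ k i else 0)
  have hrow : (LinearMap.toMatrix' (Φ.laplacian c)).charmatrix =
      fun i => ∑ o : Option V, rowCoeff G c i o • row i o := by
    funext i k
    rw [Matrix.charmatrix_apply, toMatrix'_laplacian_apply, Finset.sum_apply,
      Fintype.sum_option, sum_filter]
    simp only [Pi.smul_apply, smul_eq_mul, rowCoeff, row, Option.elim_none, Option.elim_some]
    rw [map_sum, sub_eq_add_neg, ← sum_neg_distrib]
    congr 1
    · rcases eq_or_ne i k with rfl | h <;> simp [*]
    · refine sum_congr rfl fun j _ => ?_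
      by_cases hj : G.Adj i j
      · rcases eq_or_ne j k with rfl | h
        · simp [hj]
        · rcases eq_or_ne i k with rfl | hik <;> simp [*]
      · simp [hj]
  rw [hrow]
  -- Each row is now a sum over `Option V`, so multilinearity yields a sum over all maps `V → Option
  -- V`.
  change (Matrix.detRowAlternating (n := V) (R := K[X])).toMultilinearMap _ = _
  rw [MultilinearMap.map_sum]
  refine sum_congr rfl fun f _ => ?_
  rw [MultilinearMap.map_smul_univ, smul_eq_mul, RingHom.map_det]
  rfl

theorem prod_rowCoeff_mul_det (Φ : LineBundleConnection G K) (c : Sym2 V → K) {H : SimpleGraph V}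
    (hHG : H ≤ G) {f : V → Option V} (hf : H.IsOrientedBy f) :
    (∏ i, rowCoeff G c i (f i)) * C (successorMatrix Φ.φ f).det =
      C ((-1) ^ Nat.card H.edgeSet * ((∏ e ∈ H.edgeFinset, c e) * (successorMatrix Φ.φ f).det)) *
        X ^ (Fintype.card V - Nat.card H.edgeSet) := by
  by_cases hanti : IsAntisymmetricMap f
  · have hE : Nat.card H.edgeSet = #H.edgeFinset := by
      rw [Nat.card_eq_fintype_card, SimpleGraph.edgeFinset_card]
    have hsome : ∏ i with (f i).isSome, rowCoeff G c i (f i) =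
        C ((-1) ^ #H.edgeFinset * ∏ e ∈ H.edgeFinset, c e) := by
      rw [hf.prod_edgeFinset hanti, hf.card_edgeFinset hanti, ← prod_neg, map_prod]
      refine prod_congr rfl fun i hi => ?_
      obtain ⟨j, hj⟩ := Option.isSome_iff_exists.1 (mem_filter.1 hi).2
      have hij : G.Adj i j := hHG ((hf i j).2 (Or.inl hj))
      simp [hj, rowCoeff, hij]
    have hnone : ∏ i with ¬ (f i).isSome, rowCoeff G c i (f i) =
        X ^ (Fintype.card V - #H.edgeFinset) := by
      rw [hf.card_edgeFinset hanti, ← card_univ,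
        ← card_filter_add_card_filter_not (s := univ) (fun i => (f i).isSome), Nat.add_sub_cancel_left,
        ← prod_const]
      refine prod_congr rfl fun i hi => ?_
      have : f i = none := by simpa using hi
      simp [this, rowCoeff]
    rw [← prod_filter_mul_prod_filter_not univ fun i => (f i).isSome, hsome, hnone, hE]
    simp only [map_mul]
    ring
  -- With a 2-cycle the powers of `X` need not agree, but the determinant makes both sides zero.
  · simp only [IsAntisymmetricMap] at hanti
    push Not at hanti
    obtain ⟨i, j, hi, hj⟩ := hanti
    have hadj := (hf i j).2 (Or.inl hi)
    rw [det_successorMatrix_eq_zero_of_two_cycle hadj.ne hi hj (Φ.mul_symm (hHG hadj))]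
    simp

theorem sum_fiber_eq (Φ : LineBundleConnection G K) (c : Sym2 V → K) {H : SimpleGraph V}
    (hHG : H ≤ G) :
    ∑ f : V → Option V with H.IsOrientedBy f,
        (∏ i, rowCoeff G c i (f i)) * C (successorMatrix Φ.φ f).det =
      C ((-1) ^ Nat.card H.edgeSet * ((∏ e ∈ H.edgeFinset, c e) * orientationSum Φ.φ H)) *
        X ^ (Fintype.card V - Nat.card H.edgeSet) := by
  rw [sum_congr rfl fun f hf => Φ.prod_rowCoeff_mul_det c hHG (mem_filter.1 hf).2, ← sum_mul,
    ← map_sum, ← mul_sum, ← mul_sum, orientationSum]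

theorem prod_rowCoeff_eq_zero {c : Sym2 V → K} {f : V → Option V} {i j : V} (hf : f i = some j)
    (h : ¬ G.Adj i j) : ∏ i, rowCoeff G c i (f i) = 0 :=
  prod_eq_zero (mem_univ i) (by simp [hf, rowCoeff, h])

/-- If `H` has more edges than vertices, the exponent truncates to 0, harmlessly: `H` has no
antisymmetric orientation, so its `orientationSum` is 0. -/
theorem charpoly_laplacian_eq_sum_graphs (Φ : LineBundleConnection G K) (c : Sym2 V → K) :
    (Φ.laplacian c).charpoly = ∑ H : SimpleGraph V with H ≤ G,
      C ((-1) ^ Nat.card H.edgeSet * ((∏ e ∈ H.edgeFinset, c e) * orientationSum Φ.φ H)) *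
        X ^ (Fintype.card V - Nat.card H.edgeSet) := by
  rw [charpoly_laplacian_eq_sum,
    ← sum_filter_add_sum_filter_not univ fun f : V → Option V => ∀ i j, f i = some j → G.Adj i j,
    sum_eq_zero (s := {f : V → Option V | ¬ ∀ i j, f i = some j → G.Adj i j}), add_zero,
    ← sum_fiberwise_of_maps_to (t := {H : SimpleGraph V | H ≤ G})
      (g := fun f => SimpleGraph.fromRel fun i j => f i = some j)]
  · refine sum_congr rfl fun H hH => ?_
    have hHG : H ≤ G := by simpa using hH
    rw [← Φ.sum_fiber_eq c hHG]
    refine sum_congr ?_ fun _ _ => rfl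
    ext f
    simp only [mem_filter, mem_univ, true_and]
    constructor
    · rintro ⟨h, rfl⟩ i j
      rw [SimpleGraph.fromRel_adj]
      refine ⟨fun h => h.2, fun h' => ⟨?_, h'⟩⟩
      rintro rfl
      -- `fromRel` discards loops, but nothing is lost: a fixed point of `f` would be a loop of `G`.
      exact G.loopless.irrefl i (h i i (by simpa using h'))
    · intro h
      refine ⟨fun i j hij => hHG ((h i j).2 (Or.inl hij)), ?_⟩
      ext i j
      rw [SimpleGraph.fromRel_adj, h i j]
      refine ⟨fun h' => h'.2, fun h' => ⟨((h i j).2 h').ne, h'⟩⟩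
  · intro f hf
    simp only [mem_filter, mem_univ, true_and] at hf ⊢
    intro i j hij
    rw [SimpleGraph.fromRel_adj] at hij
    exact hij.2.elim (hf i j) fun h => (hf j i h).symm
  · intro f hf
    simp only [mem_filter, mem_univ, true_and, not_forall] at hf
    obtain ⟨i, j, hij, h⟩ := hf
    rw [prod_rowCoeff_eq_zero hij h, zero_mul]

theorem charpoly_laplacian (Φ : LineBundleConnection G K) (c : Sym2 V → K) :
    (Φ.laplacian c).charpoly = ∑ k ∈ range (Fintype.card V + 1),
      C ((-1) ^ k * ∑ H ∈ G.mixedForests k, Φ.forestWeight c H) * X ^ (Fintype.card V - k) := by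
  have h1 : (Φ.laplacian c).charpoly =
      ∑ H : SimpleGraph V with H ≤ G ∧ H.IsMixedForest,
        C ((-1) ^ Nat.card H.edgeSet * Φ.forestWeight c H) *
          X ^ (Fintype.card V - Nat.card H.edgeSet) := by
    rw [charpoly_laplacian_eq_sum_graphs]
    symm
    refine sum_subset_zero_on_sdiff (fun H hH => ?_) (fun H hH => ?_) fun H hH => ?_
    · simp only [mem_filter, mem_univ, true_and] at hH ⊢
      exact hH.1
    · simp only [mem_sdiff, mem_filter, mem_univ, true_and, not_and] at hH
      rw [Φ.orientationSum_eq_zero_of_not_isMixedForest hH.1 (hH.2 hH.1)]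
      simp
    · simp only [mem_filter, mem_univ, true_and] at hH
      rw [Φ.forestWeight_eq c hH.1 hH.2]
  rw [h1, ← sum_fiberwise_of_maps_to (t := range (Fintype.card V + 1))
    (g := fun H : SimpleGraph V => Nat.card H.edgeSet)]
  · refine sum_congr rfl fun k _ => ?_
    rw [mul_sum, map_sum, sum_mul]
    refine sum_congr ?_ fun H hH => ?_
    · ext H
      simp [SimpleGraph.mixedForests, and_assoc]
    · have : Nat.card H.edgeSet = k := (mem_filter.1 hH).2.2.2
      rw [this]
  · intro H hH
    have hH' : H ≤ G ∧ H.IsMixedForest := by simpa using hH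
    -- A mixed forest has at most as many edges as vertices, so the range of `k` omits none.
    have := hH'.2.card_trees_add_card_edgeSet
    rw [mem_range]
    omega

end LineBundleConnection

theorem theorem2 {V : Type*} [Fintype V] (G : SimpleGraph V) {K : Type*} [Field K]
    (Φ : LineBundleConnection G K) (c : Sym2 V → K) :
    (Φ.laplacian c).charpoly =
        ∑ k ∈ Finset.range (Fintype.card V + 1),
          Polynomial.C ((-1) ^ k * ∑ H ∈ G.mixedForests k, Φ.forestWeight c H) *
            Polynomial.X ^ (Fintype.card V - k) ∧
      ∀ k : ℕ, ∀ H ∈ G.mixedForests k,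
        Nat.card {C : H.ConnectedComponent // C.toSimpleGraph.IsTree} + k = Fintype.card V := by
  refine ⟨Φ.charpoly_laplacian c, fun k H hH => ?_⟩
  simp only [SimpleGraph.mixedForests, Finset.mem_filter, Finset.mem_univ, true_and] at hH
  rw [← hH.2.2]
  exact hH.2.1.card_trees_add_card_edgeSet
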